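/- Let $q$ be a power of an odd prime, $G=\mathrm{PSL}(2,q^2)$, let $M$ be a maximal subgroup of $G$ isomorphic to $\mathrm{PGL}(2,q)$, and let $g\in M$ be an involution. Let $\mathcal P=g^G$ be the conjugacy class of $g$ in $G$ and let $\mathcal B=\{(M\cap g^G)^y : y\in G\}$ be the set of all $G$-conjugates of $M\cap g^G$, where $B^y=y^{-1}By$. Then $(\mathcal P,\mathcal B)$ is a $1$-$\left(\frac{q^2(q^2+1)}{2},\,q^2,\,q\right)$ design: $|\mathcal P|=\frac{q^2(q^2+1)}{2}$, every block is a subset of $\mathcal P$ with exactly $q^2$ elements, and every point lies in exactly $q$ blocks. Moreover, for $x\in\mathcal P$ let $I_x$ be the intersection of all blocks that contain $x$. Then for every $x\in\mathcal P$ we have $|I_x|=1$ if $q>3$, and $|I_x|=3$ if $q=3$. -/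

import Mathlib

/-- The pair `(P, 𝓑)` of a point set and a set of blocks is a `t`-`(v, k, lam)` design: there are
exactly `v` points, every block consists of exactly `k` points, and any `t` distinct points lie
together in exactly `lam` blocks. -/
structure IsDesign {α : Type*} (P : Set α) (𝓑 : Set (Set α)) (t v k lam : ℕ) : Prop where
  finite_points : P.Finite
  card_points : P.ncard = v
  block_subset : ∀ B ∈ 𝓑, B ⊆ P
  card_block : ∀ B ∈ 𝓑, B.ncard = k
  card_blocks_through : ∀ T : Set α, T ⊆ P → T.ncard = t → {B ∈ 𝓑 | T ⊆ B}.ncard = lam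

/-- `pointClass 𝓑 x` is `I_x`, the intersection of all blocks that contain `x`. -/
def pointClass {α : Type*} (𝓑 : Set (Set α)) (x : α) : Set α :=
  ⋂₀ {B ∈ 𝓑 | x ∈ B}

/-- The conjugate `B ^ y = {y⁻¹ u y : u ∈ B}` of a subset `B` of a group. -/
def conjSet {G : Type*} [Group G] (B : Set G) (y : G) : Set G :=
  (fun u => y⁻¹ * u * y) '' B

/-- The point set of the Method-2 design: the conjugacy class `g ^ G`. -/
def method2Points {G : Type*} [Group G] (g : G) : Set G :=
  conjugatesOf g

/-- The block set of the Method-2 design: all conjugates `(M ∩ g ^ G) ^ y` with `y ∈ G`. -/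
def method2Blocks {G : Type*} [Group G] (M : Subgroup G) (g : G) : Set (Set G) :=
  {B | ∃ y : G, B = conjSet ((M : Set G) ∩ conjugatesOf g) y}

/-!
The embedding of `PGL(2, q)` in `G = PSL(2, q²)` is never described: everything follows from a few
numbers.

Involutions of `PSL₂` and `PGL₂` are the images of trace-zero matrices
(`sq_scalar_and_not_scalar_iff_trace_eq_zero`), so counting points on the quadrics `a² + bc = k`
gives their numbers: `q²` in `M`, and `q² (q² + 1) / 2` in `G`, where they form a single class since
`-1` is a square in the field of order `q²` (`isConj_of_orderOf_eq_two_PSL_two`). The points are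
thus all involutions of `G`, and a block has `q²` points. By maximality `M` is the stabilizer of its
block (`stabilizer_block_eq`), so there are `|G : M|` blocks, and double counting puts `q` of them
through each point.

For the classes `I_x`, let `m = |I_x|` and let `C` be the centralizer of `x`, of order `q² - 1`.
* If `y ∈ I_x` then `I_y = I_x`, so blocks are unions of classes and `m` divides `q²`
  (`ncard_pointClass_dvd_ncard_block`).
* `C` acts on `I_x \ {x}` with point stabilizers `C(x) ∩ C(y)`, whose orders divide four
  (`card_centralizer_inf_centralizer_dvd_four`), so `q² - 1` divides `4 (m - 1)`.
* `m ≠ q²`, since otherwise `I_x` would be the only block through `x`.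

These conditions force `m = 1`, or `q = 3` and `m = 3` (`eq_one_or_eq_three_of_dvd`). When `q = 3`,
the group `C` has order eight and permutes the three blocks through `x`; the kernel of this action
has order at least four and yields a second point of `I_x` (`exists_ne_mem_pointClass`).
-/

/-! ### Trace-zero matrices of size two -/

section TraceZero

open Matrix

variable {F : Type*} [Field F]

/-- An invertible matrix of size two is an involution modulo scalars exactly when its trace is
zero. This is the Cayley–Hamilton identity `A² = (tr A) A - det A`. -/
theorem sq_scalar_and_not_scalar_iff_trace_eq_zero (h2 : (2 : F) ≠ 0)
    (A : Matrix (Fin 2) (Fin 2) F) (hA : A.det ≠ 0) :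
    (A * A ∈ Set.range (scalar (Fin 2)) ∧ A ∉ Set.range (scalar (Fin 2))) ↔ A.trace = 0 := by
  have e : ∀ B : Matrix (Fin 2) (Fin 2) F,
      B ∈ Set.range (scalar (Fin 2)) ↔ B 0 1 = 0 ∧ B 1 0 = 0 ∧ B 0 0 = B 1 1 := by
    intro B
    constructor
    · rintro ⟨r, rfl⟩
      simp [scalar_apply]
    · rintro ⟨h1, h3, h4⟩
      refine ⟨B 0 0, ?_⟩
      ext i j
      fin_cases i <;> fin_cases j <;> simp [scalar_apply, h1, h3, h4]
  rw [e, e]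
  simp only [det_fin_two, trace_fin_two, mul_apply, Fin.sum_univ_two] at hA ⊢
  generalize A 0 0 = a, A 0 1 = b, A 1 0 = c, A 1 1 = d at *
  constructor
  · rintro ⟨⟨h1, h3, h4⟩, h5⟩
    by_contra h
    have hb : b = 0 := by
      have : b * (a + d) = 0 := by linear_combination h1
      exact (mul_eq_zero.mp this).resolve_right h
    have hc : c = 0 := by
      have : c * (a + d) = 0 := by linear_combination h3
      exact (mul_eq_zero.mp this).resolve_right h
    refine h5 ⟨hb, hc, ?_⟩
    have : (a - d) * (a + d) = 0 := by linear_combination h4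
    exact sub_eq_zero.mp ((mul_eq_zero.mp this).resolve_right h)
  · intro h
    obtain rfl : d = -a := by linear_combination h
    refine ⟨⟨by ring, by ring, by ring⟩, ?_⟩
    rintro ⟨rfl, rfl, h3⟩
    have : 2 * a = 0 := by linear_combination h3
    have := (mul_eq_zero.mp this).resolve_left h2
    simp [this] at hA

/-- The surface `a² + bc = k`, with coordinates sorted by whether `b` vanishes. -/
noncomputable def quadricEquiv (k : F) :
    {p : F × F × F // p.1 ^ 2 + p.2.1 * p.2.2 = k} ≃ (Fˣ × F) ⊕ ({a : F // a ^ 2 = k} × F) := by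
  classical
  exact
  { toFun := fun p => if h : p.1.2.1 = 0 then
        Sum.inr (⟨p.1.1, by have := p.2; rw [h] at this; simpa using this⟩, p.1.2.2)
      else Sum.inl (Units.mk0 _ h, p.1.1)
    invFun := fun s => s.elim
      (fun x => ⟨(x.2, x.1, (k - x.2 ^ 2) / x.1), by
        have := x.1.ne_zero
        field_simp
        ring⟩)
      (fun y => ⟨(y.1, 0, y.2), by simpa using y.1.2⟩)
    left_inv := by
      rintro ⟨⟨a, b, c⟩, h⟩
      by_cases hb : b = 0
      · simp [hb]
      · simp only [hb, dite_false, Sum.elim_inl, Units.val_mk0, Subtype.mk.injEq, Prod.mk.injEq,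
          true_and]
        field_simp
        simp only at h
        linear_combination -h
    right_inv := by
      rintro (⟨b, a⟩ | ⟨⟨a, ha⟩, c⟩)
      · simp
      · simp }

theorem card_quadric [Finite F] (k : F) :
    Nat.card {p : F × F × F // p.1 ^ 2 + p.2.1 * p.2.2 = k} =
      (Nat.card F - 1) * Nat.card F + Nat.card {a : F // a ^ 2 = k} * Nat.card F := by
  rw [Nat.card_congr (quadricEquiv k), Nat.card_sum, Nat.card_prod, Nat.card_prod, Nat.card_units]

end TraceZero

/-! ### Orders and involutions of `PGL₂` -/

section PGL

open Matrix

variable (F : Type*) [Field F]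

theorem card_GL_two [Finite F] : Nat.card (GL (Fin 2) F) =
    (Nat.card F ^ 2 - 1) * (Nat.card F ^ 2 - Nat.card F) := by
  have := Fintype.ofFinite F
  rw [card_GL_field, Fin.prod_univ_two, Nat.card_eq_fintype_card]
  simp

theorem card_center_GL_two : Nat.card (Subgroup.center (GL (Fin 2) F)) = Nat.card F - 1 := by
  rw [GeneralLinearGroup.center_eq_range_scalar, ← Nat.card_units]
  refine (Nat.card_congr (MonoidHom.ofInjective ?_).toEquiv).symm
  intro a b h
  have := congrArg (fun A : GL (Fin 2) F => A.val 0 0) h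
  simpa [Units.ext_iff] using this

theorem card_PGL_two [Finite F] : Nat.card (ProjGenLinGroup (Fin 2) F) =
    Nat.card F * (Nat.card F ^ 2 - 1) := by
  have h := Subgroup.card_eq_card_quotient_mul_card_subgroup (Subgroup.center (GL (Fin 2) F))
  rw [card_center_GL_two, card_GL_two] at h
  change _ = Nat.card (ProjGenLinGroup (Fin 2) F) * _ at h
  have h1 : 1 < Nat.card F := Finite.one_lt_card
  apply Nat.eq_of_mul_eq_mul_right (Nat.sub_pos_of_lt h1)
  rw [← h, sq (Nat.card F), ← Nat.sub_one_mul]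
  ring

variable {F}

theorem orderOf_mk_PGL_two_eq_two_iff (h2 : (2 : F) ≠ 0) (A : GL (Fin 2) F) :
    orderOf (ProjGenLinGroup.mk A) = 2 ↔ A.val.trace = 0 := by
  rw [orderOf_eq_prime_iff, ← map_pow, Ne, ProjGenLinGroup.mk_eq_one, ProjGenLinGroup.mk_eq_one,
    GeneralLinearGroup.mem_center_iff_val_mem_range_scalar,
    GeneralLinearGroup.mem_center_iff_val_mem_range_scalar, sq, Units.val_mul]
  exact sq_scalar_and_not_scalar_iff_trace_eq_zero h2 _ A.det.ne_zero

/-- Invertible trace-zero matrices as triples of entries off the cone `a² + bc = 0`. -/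
noncomputable def traceZeroGLEquiv : {A : GL (Fin 2) F // A.val.trace = 0} ≃
    {p : F × F × F // ¬ p.1 ^ 2 + p.2.1 * p.2.2 = 0} where
  toFun A := ⟨(A.1.val 0 0, A.1.val 0 1, A.1.val 1 0), by
    have h := A.1.det.ne_zero
    have ht := A.2
    rw [GeneralLinearGroup.val_det_apply, det_fin_two] at h
    rw [trace_fin_two] at ht
    contrapose! h
    linear_combination A.1.val 0 0 * ht - h⟩
  invFun p := ⟨GeneralLinearGroup.mkOfDetNeZero !![p.1.1, p.1.2.1; p.1.2.2, -p.1.1] (by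
    have := p.2
    contrapose! this
    rw [det_fin_two_of] at this
    linear_combination -this), by
      simp [GeneralLinearGroup.mkOfDetNeZero, trace_fin_two]⟩
  left_inv A := by
    have ht := A.2
    rw [trace_fin_two] at ht
    apply Subtype.ext
    ext i j
    fin_cases i <;> fin_cases j <;> simp [GeneralLinearGroup.mkOfDetNeZero]
    linear_combination -ht
  right_inv p := by
    simp [GeneralLinearGroup.mkOfDetNeZero]

theorem card_traceZero_GL_two [Finite F] : Nat.card {A : GL (Fin 2) F // A.val.trace = 0} =
    (Nat.card F - 1) * Nat.card F ^ 2 := by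
  classical
  rw [Nat.card_congr traceZeroGLEquiv]
  have h := Nat.card_congr
    (Equiv.sumCompl fun p : F × F × F => p.1 ^ 2 + p.2.1 * p.2.2 = 0)
  have h0 : Nat.card {a : F // a ^ 2 = 0} = 1 := by simp
  rw [Nat.card_sum, card_quadric, h0, Nat.card_prod, Nat.card_prod] at h
  obtain ⟨n, hn⟩ : ∃ n, Nat.card F = n + 1 := Nat.exists_eq_succ_of_ne_zero Nat.card_pos.ne'
  rw [hn] at h ⊢
  simp only [Nat.add_sub_cancel] at h ⊢
  nlinarith

theorem ncard_involutions_PGL_two [Finite F] (h2 : (2 : F) ≠ 0) :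
    {x : ProjGenLinGroup (Fin 2) F | orderOf x = 2}.ncard = Nat.card F ^ 2 := by
  have h := QuotientGroup.card_preimage_mk (Subgroup.center (GL (Fin 2) F))
    {x : ProjGenLinGroup (Fin 2) F | orderOf x = 2}
  have e : (QuotientGroup.mk ⁻¹' {x : ProjGenLinGroup (Fin 2) F | orderOf x = 2} :
      Set (GL (Fin 2) F)) = {A | A.val.trace = 0} :=
    Set.ext fun A => orderOf_mk_PGL_two_eq_two_iff h2 A
  rw [e, card_center_GL_two, Set.coe_ofPred, card_traceZero_GL_two] at h
  have h1 : 1 < Nat.card F := Finite.one_lt_card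
  exact (Nat.eq_of_mul_eq_mul_left (Nat.sub_pos_of_lt h1) h).symm

end PGL

/-! ### Orders and involutions of `PSL₂` -/

section PSL

open Matrix

variable (K : Type*) [Field K]

/-- `SL₂` is the kernel of the surjective determinant on `GL₂`. -/
theorem card_SL_two [Finite K] : Nat.card (Matrix.SpecialLinearGroup (Fin 2) K) =
    Nat.card K * (Nat.card K ^ 2 - 1) := by
  have hs : Function.Surjective (GeneralLinearGroup.det : GL (Fin 2) K →* Kˣ) := by
    intro u
    refine ⟨GeneralLinearGroup.mkOfDetNeZero !![(u : K), 0; 0, 1] (by simp), ?_⟩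
    ext
    simp [GeneralLinearGroup.mkOfDetNeZero]
  have hk : (Matrix.SpecialLinearGroup.toGL : Matrix.SpecialLinearGroup (Fin 2) K →* _).range =
      (GeneralLinearGroup.det : GL (Fin 2) K →* Kˣ).ker := by
    ext A
    constructor
    · rintro ⟨B, rfl⟩
      ext
      simp
    · intro h
      refine ⟨⟨A.val, ?_⟩, ?_⟩
      · simpa using congrArg Units.val (MonoidHom.mem_ker.mp h)
      · ext
        rfl
  have h := Subgroup.card_eq_card_quotient_mul_card_subgroup
    (GeneralLinearGroup.det : GL (Fin 2) K →* Kˣ).ker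
  rw [Nat.card_congr (QuotientGroup.quotientKerEquivOfSurjective _ hs).toEquiv, Nat.card_units,
    card_GL_two, ← hk, ← Nat.card_congr
      (MonoidHom.ofInjective Matrix.SpecialLinearGroup.toGL_injective).toEquiv] at h
  have h1 : 1 < Nat.card K := Finite.one_lt_card
  apply Nat.eq_of_mul_eq_mul_left (Nat.sub_pos_of_lt h1)
  rw [← h, sq (Nat.card K), ← Nat.sub_one_mul]
  ring

variable {K}

theorem card_sq_eq_sq (h2 : (2 : K) ≠ 0) {i : K} (hi : i ≠ 0) :
    Nat.card {a : K // a ^ 2 = i ^ 2} = 2 := by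
  have e : {a : K | a ^ 2 = i ^ 2} = {i, -i} := by
    ext a
    simp [sq_eq_sq_iff_eq_or_eq_neg]
  have : ({i, -i} : Set K).ncard = 2 := by
    apply Set.ncard_pair
    intro h
    have : 2 * i = 0 := by linear_combination h
    exact hi ((mul_eq_zero.mp this).resolve_left h2)
  rw [← e] at this
  exact this

theorem SL_two_mem_center_iff {A : Matrix.SpecialLinearGroup (Fin 2) K} :
    A ∈ Subgroup.center (Matrix.SpecialLinearGroup (Fin 2) K) ↔
      A.val ∈ Set.range (scalar (Fin 2)) := by
  rw [Matrix.SpecialLinearGroup.mem_center_iff]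
  constructor
  · rintro ⟨r, -, h⟩
    exact ⟨r, h⟩
  · rintro ⟨r, h⟩
    refine ⟨r, ?_, h⟩
    have := A.2
    rw [← h, scalar_apply, det_diagonal] at this
    simpa using this

theorem SL_two_mem_center_iff_eq {A : Matrix.SpecialLinearGroup (Fin 2) K} :
    A ∈ Subgroup.center (Matrix.SpecialLinearGroup (Fin 2) K) ↔ A = 1 ∨ A = -1 := by
  rw [Matrix.SpecialLinearGroup.mem_center_iff]
  constructor
  · rintro ⟨r, hr, h⟩
    rw [Fintype.card_fin, sq_eq_one_iff] at hr
    rcases hr with rfl | rfl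
    · left
      apply Subtype.ext
      rw [← h, map_one, Matrix.SpecialLinearGroup.coe_one]
    · right
      apply Subtype.ext
      rw [← h, map_neg, map_one, Matrix.SpecialLinearGroup.coe_neg,
        Matrix.SpecialLinearGroup.coe_one]
  · rintro (rfl | rfl)
    · exact ⟨1, by simp, by rw [map_one, Matrix.SpecialLinearGroup.coe_one]⟩
    · exact ⟨-1, by simp, by rw [map_neg, map_one, Matrix.SpecialLinearGroup.coe_neg,
        Matrix.SpecialLinearGroup.coe_one]⟩

theorem card_center_SL_two (h2 : (2 : K) ≠ 0) :
    Nat.card (Subgroup.center (Matrix.SpecialLinearGroup (Fin 2) K)) = 2 := by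
  have e : (Subgroup.center (Matrix.SpecialLinearGroup (Fin 2) K) :
      Set (Matrix.SpecialLinearGroup (Fin 2) K)) = {1, -1} := by
    ext A
    simp [SL_two_mem_center_iff_eq]
  have : ({1, -1} : Set (Matrix.SpecialLinearGroup (Fin 2) K)).ncard = 2 := by
    apply Set.ncard_pair
    intro h
    have := congrArg (fun A : Matrix.SpecialLinearGroup (Fin 2) K => A.val 0 0) h
    simp only [Matrix.SpecialLinearGroup.coe_one, Matrix.SpecialLinearGroup.coe_neg,
      Matrix.neg_apply, one_apply_eq] at this
    exact h2 (by linear_combination this)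
  rw [← e] at this
  exact this

theorem card_PSL_two [Finite K] (h2 : (2 : K) ≠ 0) :
    2 * Nat.card (ProjectiveSpecialLinearGroup (Fin 2) K) = Nat.card K * (Nat.card K ^ 2 - 1) := by
  have h := Subgroup.card_eq_card_quotient_mul_card_subgroup
    (Subgroup.center (Matrix.SpecialLinearGroup (Fin 2) K))
  rw [card_center_SL_two h2, card_SL_two] at h
  rw [h, mul_comm]

theorem orderOf_mk_PSL_two_eq_two_iff (h2 : (2 : K) ≠ 0) (A : Matrix.SpecialLinearGroup (Fin 2) K) :
    orderOf (A : ProjectiveSpecialLinearGroup (Fin 2) K) = 2 ↔ A.val.trace = 0 := by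
  rw [orderOf_eq_prime_iff, ← QuotientGroup.mk_pow, Ne, QuotientGroup.eq_one_iff,
    QuotientGroup.eq_one_iff, SL_two_mem_center_iff, SL_two_mem_center_iff, sq,
    Matrix.SpecialLinearGroup.coe_mul]
  exact sq_scalar_and_not_scalar_iff_trace_eq_zero h2 _ (by simp)

/-- Trace-zero matrices of determinant one as points of the surface `a² + bc = -1`. -/
noncomputable def traceZeroSLEquiv : {A : Matrix.SpecialLinearGroup (Fin 2) K // A.val.trace = 0} ≃
    {p : K × K × K // p.1 ^ 2 + p.2.1 * p.2.2 = -1} where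
  toFun A := ⟨(A.1.val 0 0, A.1.val 0 1, A.1.val 1 0), by
    have h := A.1.2
    have ht := A.2
    rw [det_fin_two] at h
    rw [trace_fin_two] at ht
    linear_combination A.1.val 0 0 * ht - h⟩
  invFun p := ⟨⟨!![p.1.1, p.1.2.1; p.1.2.2, -p.1.1], by
    have := p.2
    rw [det_fin_two_of]
    linear_combination -this⟩, by simp [trace_fin_two]⟩
  left_inv A := by
    have ht := A.2
    rw [trace_fin_two] at ht
    apply Subtype.ext
    ext i j
    fin_cases i <;> fin_cases j <;> simp
    linear_combination -ht
  right_inv p := by simp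

theorem two_mul_ncard_involutions_PSL_two [Finite K] (h2 : (2 : K) ≠ 0) {i : K} (hi : i ^ 2 = -1) :
    2 * {x : ProjectiveSpecialLinearGroup (Fin 2) K | orderOf x = 2}.ncard =
      Nat.card K * (Nat.card K + 1) := by
  have h := QuotientGroup.card_preimage_mk (Subgroup.center (Matrix.SpecialLinearGroup (Fin 2) K))
    {x : ProjectiveSpecialLinearGroup (Fin 2) K | orderOf x = 2}
  have e : (QuotientGroup.mk ⁻¹' {x : ProjectiveSpecialLinearGroup (Fin 2) K | orderOf x = 2} :
      Set (Matrix.SpecialLinearGroup (Fin 2) K)) = {A | A.val.trace = 0} :=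
    Set.ext fun A => orderOf_mk_PSL_two_eq_two_iff h2 A
  have hi0 : i ≠ 0 := by
    rintro rfl
    simp at hi
  have hr := card_sq_eq_sq h2 hi0
  rw [hi] at hr
  rw [e, card_center_SL_two h2, Set.coe_ofPred, Nat.card_congr traceZeroSLEquiv, card_quadric,
    hr] at h
  change _ = 2 * {x : ProjectiveSpecialLinearGroup (Fin 2) K | orderOf x = 2}.ncard at h
  have h1 : 1 < Nat.card K := Finite.one_lt_card
  obtain ⟨n, hn⟩ : ∃ n, Nat.card K = n + 1 := Nat.exists_eq_succ_of_ne_zero Nat.card_pos.ne'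
  rw [← h, hn, Nat.add_sub_cancel]
  ring

/-- The matrix `diag(i, -i)`, where `i² = -1`. -/
def diagI {i : K} (hi : i ^ 2 = -1) : Matrix.SpecialLinearGroup (Fin 2) K :=
  ⟨!![i, 0; 0, -i], by
    rw [det_fin_two_of]
    linear_combination -hi⟩

/-- Every trace-zero matrix of determinant one is diagonalised to `diag(i, -i)` by a matrix of
determinant one: its columns are eigenvectors, the second scaled to make the determinant one. -/
theorem exists_mul_eq_mul_diagI (h2 : (2 : K) ≠ 0) {i : K} (hi : i ^ 2 = -1)
    (A : Matrix.SpecialLinearGroup (Fin 2) K) (hA : A.val.trace = 0) :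
    ∃ P : Matrix.SpecialLinearGroup (Fin 2) K, A * P = P * diagI hi := by
  have hi0 : i ≠ 0 := by
    rintro rfl
    simp at hi
  have hd := A.2
  rw [det_fin_two] at hd
  rw [trace_fin_two] at hA
  suffices H : ∃ x y z w : K, x * w - y * z = 1 ∧
      A.val 0 0 * x + A.val 0 1 * z = x * i ∧ A.val 0 0 * y + A.val 0 1 * w = -(y * i) ∧
      A.val 1 0 * x + A.val 1 1 * z = z * i ∧ A.val 1 0 * y + A.val 1 1 * w = -(w * i) by
    obtain ⟨x, y, z, w, h, h3, h4, h5, h6⟩ := H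
    refine ⟨⟨!![x, y; z, w], by rw [det_fin_two_of]; exact h⟩, ?_⟩
    apply Subtype.ext
    change A.val * !![x, y; z, w] = !![x, y; z, w] * !![i, 0; 0, -i]
    ext j k
    fin_cases j <;> fin_cases k <;>
      simp [mul_apply, Fin.sum_univ_two, h3, h4, h5, h6]
  generalize A.val 0 0 = a, A.val 0 1 = b, A.val 1 0 = c, A.val 1 1 = d at *
  obtain rfl : d = -a := by linear_combination hA
  by_cases hb : b = 0
  · subst hb
    have : (a - i) * (a + i) = 0 := by linear_combination -hd - hi
    rcases mul_eq_zero.mp this with h | h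
    · obtain rfl : a = i := by linear_combination h
      refine ⟨2 * a, 0, c, 1 / (2 * a), ?_, ?_, ?_, ?_, ?_⟩ <;> field_simp <;> ring
    · obtain rfl : a = -i := by linear_combination h
      refine ⟨0, -1, 1, c / (2 * i), ?_, ?_, ?_, ?_, ?_⟩ <;> field_simp <;> ring
  · refine ⟨b, -1 / (2 * i), i - a, (i + a) / (2 * i * b), ?_, ?_, ?_, ?_, ?_⟩ <;> field_simp
    · ring
    · ring
    · ring
    · linear_combination -hi - hd
    · linear_combination hi + hd

theorem isConj_of_orderOf_eq_two_PSL_two (h2 : (2 : K) ≠ 0) {i : K} (hi : i ^ 2 = -1)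
    {x y : ProjectiveSpecialLinearGroup (Fin 2) K} (hx : orderOf x = 2) (hy : orderOf y = 2) :
    IsConj x y := by
  have key : ∀ x : ProjectiveSpecialLinearGroup (Fin 2) K, orderOf x = 2 →
      IsConj (diagI hi : ProjectiveSpecialLinearGroup (Fin 2) K) x := by
    intro x hx
    induction x using QuotientGroup.induction_on with | H A =>
    obtain ⟨P, hP⟩ := exists_mul_eq_mul_diagI h2 hi A ((orderOf_mk_PSL_two_eq_two_iff h2 A).mp hx)
    rw [isConj_iff]
    refine ⟨P, ?_⟩
    rw [← QuotientGroup.mk_mul, ← hP, QuotientGroup.mk_mul, mul_inv_cancel_right]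
  exact (key x hx).symm.trans (key y hy)

end PSL

/-! ### Centralizers of pairs of involutions of `PSL₂` -/

section Centralizer

open Matrix

variable {K : Type*} [Field K]

/-- A matrix commuting with two trace-zero matrices `X ≠ ±Y` of determinant one is scalar: its
trace-zero part is parallel to both `X` and `Y`. -/
theorem mem_center_of_commute_of_commute (h2 : (2 : K) ≠ 0)
    {X Y W : Matrix.SpecialLinearGroup (Fin 2) K}
    (hX : X.val.trace = 0) (hY : Y.val.trace = 0) (hne : X ≠ Y) (hne' : X ≠ -Y)
    (hWX : W * X = X * W) (hWY : W * Y = Y * W) :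
    W ∈ Subgroup.center (Matrix.SpecialLinearGroup (Fin 2) K) := by
  have hdX := X.2
  have hdY := Y.2
  rw [det_fin_two] at hdX hdY
  rw [trace_fin_two] at hX hY
  have eX : W.val * X.val = X.val * W.val := congrArg Subtype.val hWX
  have eY : W.val * Y.val = Y.val * W.val := congrArg Subtype.val hWY
  have eX1 := congrFun (congrFun eX 0) 0
  have eX2 := congrFun (congrFun eX 0) 1
  have eX3 := congrFun (congrFun eX 1) 0
  have eY1 := congrFun (congrFun eY 0) 0
  have eY2 := congrFun (congrFun eY 0) 1
  have eY3 := congrFun (congrFun eY 1) 0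
  simp only [mul_apply, Fin.sum_univ_two] at eX1 eX2 eX3 eY1 eY2 eY3
  have hn : ¬ (X.val 0 0 = Y.val 0 0 ∧ X.val 0 1 = Y.val 0 1 ∧ X.val 1 0 = Y.val 1 0) := by
    rintro ⟨h3, h4, h5⟩
    refine hne (Subtype.ext (Matrix.ext fun j k => ?_))
    fin_cases j <;> fin_cases k
    · exact h3
    · exact h4
    · exact h5
    · change X.val 1 1 = Y.val 1 1
      linear_combination hX - hY - h3
  have hn' : ¬ (X.val 0 0 = -Y.val 0 0 ∧ X.val 0 1 = -Y.val 0 1 ∧ X.val 1 0 = -Y.val 1 0) := by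
    rintro ⟨h3, h4, h5⟩
    refine hne' (Subtype.ext (Matrix.ext fun j k => ?_))
    fin_cases j <;> fin_cases k
    · exact h3
    · exact h4
    · exact h5
    · change X.val 1 1 = -Y.val 1 1
      linear_combination hX + hY - h3
  suffices H : W.val 0 1 = 0 ∧ W.val 1 0 = 0 ∧ W.val 0 0 = W.val 1 1 by
    rw [SL_two_mem_center_iff]
    refine ⟨W.val 0 0, ?_⟩
    ext j k
    fin_cases j <;> fin_cases k <;> simp [scalar_apply, H.1, H.2.1, H.2.2]
  generalize X.val 0 0 = a, X.val 0 1 = b, X.val 1 0 = c, X.val 1 1 = d at *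
  generalize Y.val 0 0 = a', Y.val 0 1 = b', Y.val 1 0 = c', Y.val 1 1 = d' at *
  generalize W.val 0 0 = p, W.val 0 1 = r, W.val 1 0 = s, W.val 1 1 = t at *
  obtain rfl : d = -a := by linear_combination hX
  obtain rfl : d' = -a' := by linear_combination hY
  obtain ⟨u, rfl⟩ : ∃ u, p = t + 2 * u := ⟨(p - t) / 2, by field_simp; ring⟩
  have cancel : ∀ z : K, 2 * z = 0 → z = 0 := fun z hz => (mul_eq_zero.mp hz).resolve_left h2
  have r1 : r * c = b * s := by linear_combination eX1
  have r2 : b * u = a * r := by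
    refine sub_eq_zero.mp (cancel _ ?_)
    linear_combination eX2
  have r3 : c * u = a * s := by
    refine sub_eq_zero.mp (cancel _ ?_)
    linear_combination -eX3
  have r1' : r * c' = b' * s := by linear_combination eY1
  have r2' : b' * u = a' * r := by
    refine sub_eq_zero.mp (cancel _ ?_)
    linear_combination eY2
  have r3' : c' * u = a' * s := by
    refine sub_eq_zero.mp (cancel _ ?_)
    linear_combination -eY3
  clear eX1 eX2 eX3 eY1 eY2 eY3 hX hY eX eY
  -- If the trace-zero part `(u, r, s)` of `W` has a nonzero coordinate `n`, then `(a, b, c)` and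
  -- `(a', b', c')` are multiples of it, by `l / n` and `l' / n`.
  suffices H : ∀ n : K, n ≠ 0 → ∀ l l' : K, a * n = l * u → b * n = l * r → c * n = l * s →
      a' * n = l' * u → b' * n = l' * r → c' * n = l' * s → False by
    refine ⟨?_, ?_, ?_⟩
    · by_contra h
      exact H r h b b' (by linear_combination -r2) rfl (by linear_combination r1)
        (by linear_combination -r2') rfl (by linear_combination r1')
    · by_contra h
      exact H s h c c' (by linear_combination -r3) (by linear_combination -r1) rfl
        (by linear_combination -r3') (by linear_combination -r1') rfl
    · by_contra h
      have hu : u ≠ 0 := by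
        rintro rfl
        simp at h
      exact H u hu a a' rfl r2 r3 rfl r2' r3'
  intro n hn0 l l' h3 h4 h5 h3' h4' h5'
  have e : l ^ 2 * (u ^ 2 + r * s) = -n ^ 2 := by
    linear_combination -n ^ 2 * hdX - (a * n + l * u) * h3 - c * n * h4 - l * r * h5
  have e' : l' ^ 2 * (u ^ 2 + r * s) = -n ^ 2 := by
    linear_combination -n ^ 2 * hdY - (a' * n + l' * u) * h3' - c' * n * h4' - l' * r * h5'
  have hN : u ^ 2 + r * s ≠ 0 := by
    intro h
    rw [h, mul_zero] at e
    exact pow_ne_zero 2 hn0 (neg_eq_zero.mp e.symm)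
  have : (l - l') * (l + l') = 0 := by
    refine (mul_eq_zero.mp (?_ : _ * (u ^ 2 + r * s) = 0)).resolve_right hN
    linear_combination e - e'
  rcases mul_eq_zero.mp this with h | h
  · obtain rfl : l = l' := by linear_combination h
    exact hn ⟨mul_right_cancel₀ hn0 (h3.trans h3'.symm), mul_right_cancel₀ hn0 (h4.trans h4'.symm),
      mul_right_cancel₀ hn0 (h5.trans h5'.symm)⟩
  · obtain rfl : l = -l' := by linear_combination h
    refine hn' ⟨mul_right_cancel₀ hn0 ?_, mul_right_cancel₀ hn0 ?_, mul_right_cancel₀ hn0 ?_⟩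
    · linear_combination h3 + h3'
    · linear_combination h4 + h4'
    · linear_combination h5 + h5'

theorem PSL_two_mk_eq_mk_iff {A B : Matrix.SpecialLinearGroup (Fin 2) K} :
    (A : ProjectiveSpecialLinearGroup (Fin 2) K) = B ↔ A = B ∨ A = -B := by
  rw [eq_comm, QuotientGroup.eq, SL_two_mem_center_iff_eq, inv_mul_eq_one, inv_mul_eq_iff_eq_mul,
    mul_neg, mul_one, eq_comm]

/-- The elements of the common centralizer square to one and are determined by the pair of signs
with which their lifts to `SL₂` commute with lifts of `x` and `y`. -/
theorem card_centralizer_inf_centralizer_dvd_four [Finite K] (h2 : (2 : K) ≠ 0)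
    {x y : ProjectiveSpecialLinearGroup (Fin 2) K} (hx : orderOf x = 2) (hy : orderOf y = 2)
    (hxy : x ≠ y) :
    Nat.card (Subgroup.centralizer {x} ⊓ Subgroup.centralizer {y} : Subgroup _) ∣ 4 := by
  classical
  induction x using QuotientGroup.induction_on with | H X =>
  induction y using QuotientGroup.induction_on with | H Y =>
  rw [orderOf_mk_PSL_two_eq_two_iff h2] at hx hy
  rw [Ne, PSL_two_mk_eq_mk_iff, not_or] at hxy
  have key : ∀ W : Matrix.SpecialLinearGroup (Fin 2) K, W * X = X * W → W * Y = Y * W →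
      (W : ProjectiveSpecialLinearGroup (Fin 2) K) = 1 := fun W h h' =>
    (QuotientGroup.eq_one_iff W).mpr
      (mem_center_of_commute_of_commute h2 hx hy hxy.1 hxy.2 h h')
  have sign : ∀ W Z : Matrix.SpecialLinearGroup (Fin 2) K,
      (W : ProjectiveSpecialLinearGroup (Fin 2) K) ∈
        Subgroup.centralizer {(Z : ProjectiveSpecialLinearGroup (Fin 2) K)} →
      W * Z = Z * W ∨ W * Z = -(Z * W) := by
    intro W Z h
    rw [Subgroup.mem_centralizer_singleton_iff, ← QuotientGroup.mk_mul, ← QuotientGroup.mk_mul,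
      PSL_two_mk_eq_mk_iff] at h
    exact h
  set H := (Subgroup.centralizer {(X : ProjectiveSpecialLinearGroup (Fin 2) K)} ⊓
    Subgroup.centralizer {(Y : ProjectiveSpecialLinearGroup (Fin 2) K)}) with hH
  have sq_one : ∀ w ∈ H, w ^ 2 = 1 := by
    intro w hw
    induction w using QuotientGroup.induction_on with | H W =>
    have aux : ∀ Z : Matrix.SpecialLinearGroup (Fin 2) K, (W * Z = Z * W ∨ W * Z = -(Z * W)) →
        W ^ 2 * Z = Z * W ^ 2 := by
      rintro Z (h | h)
      · rw [sq, mul_assoc, h, ← mul_assoc, h, mul_assoc]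
      · rw [sq, mul_assoc, h, mul_neg, ← mul_assoc, h, neg_mul, neg_neg, mul_assoc]
    rw [← QuotientGroup.mk_pow]
    exact key _ (aux X (sign W X hw.1)) (aux Y (sign W Y hw.2))
  have hp : IsPGroup 2 H := fun w => ⟨1, Subtype.ext (by simpa using sq_one w w.2)⟩
  obtain ⟨n, hn⟩ := IsPGroup.iff_card.mp hp
  -- Lifts `V`, `W` with the same signs differ by a matrix commuting with both `X` and `Y`.
  have inj : Function.Injective (fun w : H =>
      (decide (w.1.out * X = X * w.1.out), decide (w.1.out * Y = Y * w.1.out))) := by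
    intro v w hvw
    simp only [Prod.mk.injEq, decide_eq_decide] at hvw
    have hv := v.2
    have hw := w.2
    rw [← QuotientGroup.out_eq' v.1] at hv
    rw [← QuotientGroup.out_eq' w.1] at hw
    have aux : ∀ V W Z : Matrix.SpecialLinearGroup (Fin 2) K, (V * Z = Z * V ∨ V * Z = -(Z * V)) →
        (W * Z = Z * W ∨ W * Z = -(Z * W)) → (V * Z = Z * V ↔ W * Z = Z * W) →
        V⁻¹ * W * Z = Z * (V⁻¹ * W) := by
      intro V W Z hV hW h
      rw [mul_assoc, inv_mul_eq_iff_eq_mul]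
      by_cases h' : V * Z = Z * V
      · rw [h.mp h', ← mul_assoc, ← mul_assoc, h', mul_inv_cancel_right]
      · rw [hW.resolve_left (mt h.mpr h'), ← mul_assoc, ← mul_assoc, hV.resolve_left h', neg_mul,
          neg_mul, mul_inv_cancel_right]
    have := key _ (aux _ _ X (sign _ X hv.1) (sign _ X hw.1) hvw.1)
      (aux _ _ Y (sign _ Y hv.2) (sign _ Y hw.2) hvw.2)
    rw [QuotientGroup.mk_mul, QuotientGroup.mk_inv, inv_mul_eq_one, QuotientGroup.out_eq',
      QuotientGroup.out_eq'] at this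
    exact Subtype.ext this
  have hle := Nat.card_le_card_of_injective _ inj
  rw [hn] at hle ⊢
  have h4 : Nat.card (Bool × Bool) = 2 ^ 2 := by simp
  rw [h4] at hle
  exact pow_dvd_pow 2 ((Nat.pow_le_pow_iff_right one_lt_two).mp hle)

/-- The matrices `diag(i, -i)` and `!![0, 1; -1, 0]` anticommute, so their images commute. -/
theorem exists_commuting_involution_PSL_two (h2 : (2 : K) ≠ 0) {i : K} (hi : i ^ 2 = -1)
    {x : ProjectiveSpecialLinearGroup (Fin 2) K} (hx : orderOf x = 2) :
    ∃ y : ProjectiveSpecialLinearGroup (Fin 2) K, orderOf y = 2 ∧ y ≠ x ∧ y * x = x * y := by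
  have hd : (diagI hi).val.trace = 0 := by simp [diagI, trace_fin_two]
  let J : Matrix.SpecialLinearGroup (Fin 2) K := ⟨!![0, 1; -1, 0], by simp [det_fin_two_of]⟩
  have hJ : J.val.trace = 0 := by simp [J, trace_fin_two]
  obtain ⟨c, hc⟩ := isConj_iff.mp (isConj_of_orderOf_eq_two_PSL_two h2 hi
    ((orderOf_mk_PSL_two_eq_two_iff h2 _).mpr hd) hx)
  have hne : (J : ProjectiveSpecialLinearGroup (Fin 2) K) ≠ diagI hi := by
    rw [Ne, PSL_two_mk_eq_mk_iff]
    rintro (h | h)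
    · have : (1 : K) = 0 := congrFun (congrFun (congrArg Subtype.val h) 0) 1
      exact one_ne_zero this
    · have : (1 : K) = -0 := congrFun (congrFun (congrArg Subtype.val h) 0) 1
      rw [neg_zero] at this
      exact one_ne_zero this
  have hcomm : (J : ProjectiveSpecialLinearGroup (Fin 2) K) * diagI hi = diagI hi * J := by
    rw [← QuotientGroup.mk_mul, ← QuotientGroup.mk_mul, PSL_two_mk_eq_mk_iff]
    right
    apply Subtype.ext
    change !![0, 1; -1, 0] * !![i, 0; 0, -i] = -(!![i, 0; 0, -i] * !![0, 1; -1, 0])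
    ext j k
    fin_cases j <;> fin_cases k <;> simp [mul_apply, Fin.sum_univ_two]
  refine ⟨c * J * c⁻¹, ?_, ?_, ?_⟩
  · have := MulEquiv.orderOf_eq (MulAut.conj c) (J : ProjectiveSpecialLinearGroup (Fin 2) K)
    rw [MulAut.conj_apply] at this
    rw [this, orderOf_mk_PSL_two_eq_two_iff h2, hJ]
  · rw [← hc]
    simpa using hne
  · rw [← hc]
    have : ∀ a b : ProjectiveSpecialLinearGroup (Fin 2) K, c * a * c⁻¹ * (c * b * c⁻¹) =
      c * (a * b) * c⁻¹ := fun a b => by group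
    rw [this, this, hcomm]

end Centralizer

/-! ### Block systems invariant under a group action -/

section Action

open scoped Pointwise

variable {A α : Type*}

theorem mem_pointClass_self (𝓑 : Set (Set α)) (x : α) : x ∈ pointClass 𝓑 x :=
  fun _ hB => hB.2

theorem mem_pointClass {𝓑 : Set (Set α)} {x y : α} :
    y ∈ pointClass 𝓑 x ↔ ∀ B ∈ 𝓑, x ∈ B → y ∈ B :=
  ⟨fun h B hB hx => h B ⟨hB, hx⟩, fun h B hB => h B hB.1 hB.2⟩

theorem pointClass_subset {𝓑 : Set (Set α)} {B : Set α} (hB : B ∈ 𝓑) {x : α} (hx : x ∈ B) :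
    pointClass 𝓑 x ⊆ B :=
  fun _ hy => mem_pointClass.mp hy B hB hx

/-- Counting incident point–block pairs in two ways. -/
theorem ncard_mul_eq_ncard_mul [Finite α] {P : Set α} {𝓑 : Set (Set α)} {k r : ℕ}
    (hP : ∀ B ∈ 𝓑, B ⊆ P) (hk : ∀ B ∈ 𝓑, B.ncard = k)
    (hr : ∀ x ∈ P, {B ∈ 𝓑 | x ∈ B}.ncard = r) : P.ncard * r = 𝓑.ncard * k := by
  classical
  have := Fintype.ofFinite α
  have h := Finset.sum_card_bipartiteAbove_eq_sum_card_bipartiteBelow (s := P.toFinset)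
    (t := 𝓑.toFinset) (fun x B => x ∈ B)
  rw [Finset.sum_const_nat (m := r), Finset.sum_const_nat (m := k),
    ← Set.ncard_eq_toFinset_card', ← Set.ncard_eq_toFinset_card'] at h
  · exact h
  · intro B hB
    rw [Set.mem_toFinset] at hB
    rw [← hk B hB, ← Set.ncard_coe_finset]
    congr 1
    ext x
    simpa [Finset.bipartiteBelow] using fun hx => hP B hB hx
  · intro x hx
    rw [Set.mem_toFinset] at hx
    rw [← hr x hx, ← Set.ncard_coe_finset]
    congr 1
    ext B
    simp [Finset.bipartiteAbove]

variable [Group A] [MulAction A α]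

theorem ncard_blocks_through_smul {𝓑 : Set (Set α)} (h : ∀ a : A, ∀ B ∈ 𝓑, a • B ∈ 𝓑) (a : A)
    (x : α) : {B ∈ 𝓑 | a • x ∈ B}.ncard = {B ∈ 𝓑 | x ∈ B}.ncard := by
  have e : {B ∈ 𝓑 | a • x ∈ B} = (a • ·) '' {B ∈ 𝓑 | x ∈ B} := by
    ext B
    constructor
    · rintro ⟨hB, hx⟩
      exact ⟨a⁻¹ • B, ⟨h _ _ hB, by rwa [Set.mem_inv_smul_set_iff]⟩, smul_inv_smul a B⟩
    · rintro ⟨B, ⟨hB, hx⟩, rfl⟩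
      exact ⟨h _ _ hB, Set.smul_mem_smul_set hx⟩
  rw [e, Set.ncard_image_of_injective _ (MulAction.injective a)]

theorem pointClass_smul {𝓑 : Set (Set α)} (h : ∀ a : A, ∀ B ∈ 𝓑, a • B ∈ 𝓑) (a : A) (x : α) :
    pointClass 𝓑 (a • x) = a • pointClass 𝓑 x := by
  ext z
  rw [Set.mem_smul_set_iff_inv_smul_mem, mem_pointClass, mem_pointClass]
  constructor
  · intro hz B hB hx
    rw [← Set.mem_smul_set_iff_inv_smul_mem]
    exact hz _ (h a B hB) (Set.smul_mem_smul_set hx)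
  · intro hz B hB hx
    have := hz _ (h a⁻¹ B hB) (by rwa [Set.mem_inv_smul_set_iff])
    rwa [Set.mem_inv_smul_set_iff, smul_inv_smul] at this

theorem pointClass_eq_of_mem [Finite α] {𝓑 : Set (Set α)} (h : ∀ a : A, ∀ B ∈ 𝓑, a • B ∈ 𝓑)
    {x y : α} (hxy : y ∈ MulAction.orbit A x) (hy : y ∈ pointClass 𝓑 x) :
    pointClass 𝓑 y = pointClass 𝓑 x := by
  obtain ⟨a, rfl⟩ := hxy
  apply Set.eq_of_subset_of_ncard_le
  · intro z hz
    exact mem_pointClass.mpr fun B hB hx =>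
      mem_pointClass.mp hz B hB (mem_pointClass.mp hy B hB hx)
  · change _ ≤ (pointClass 𝓑 (a • x)).ncard
    rw [pointClass_smul h, Set.ncard_smul_set]
  · exact Set.toFinite _

/-- The classes `I_y` are the fibres of `y ↦ I_y`, and each block is a union of classes. -/
theorem ncard_pointClass_dvd_ncard_block [Finite α] {𝓑 : Set (Set α)}
    (h : ∀ a : A, ∀ B ∈ 𝓑, a • B ∈ 𝓑) {x : α} {B : Set α} (hB : B ∈ 𝓑)
    (hBP : B ⊆ MulAction.orbit A x) : (pointClass 𝓑 x).ncard ∣ B.ncard := by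
  classical
  have := Fintype.ofFinite α
  rw [Set.ncard_eq_toFinset_card' B, Finset.card_eq_sum_card_image (pointClass 𝓑)]
  refine Finset.dvd_sum fun I hI => ?_
  obtain ⟨y, hy, rfl⟩ := Finset.mem_image.mp hI
  rw [Set.mem_toFinset] at hy
  obtain ⟨a, rfl⟩ := hBP hy
  rw [show (pointClass 𝓑 x).ncard = (pointClass 𝓑 (a • x)).ncard by
    rw [pointClass_smul h, Set.ncard_smul_set], ← Set.ncard_coe_finset]
  apply dvd_of_eq
  congr 1
  ext z
  simp only [Finset.coe_filter, Set.mem_toFinset, Set.mem_ofPred_eq]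
  constructor
  · intro hz
    have hzB := pointClass_subset hB hy hz
    refine ⟨hzB, pointClass_eq_of_mem h ?_ hz⟩
    rw [MulAction.orbit_smul]
    exact hBP hzB
  · rintro ⟨-, hz⟩
    change pointClass 𝓑 z = pointClass 𝓑 (a • x) at hz
    rw [← hz]
    exact mem_pointClass_self _ _

theorem card_dvd_mul_card_of_card_stabilizer_dvd [Finite A] [Finite α] {d : ℕ}
    (h : ∀ x : α, Nat.card (MulAction.stabilizer A x) ∣ d) : Nat.card A ∣ d * Nat.card α := by
  classical
  have := Fintype.ofFinite α
  have := Fintype.ofFinite A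
  rw [Nat.card_eq_fintype_card (α := α), MulAction.card_eq_sum_card_group_div_card_stabilizer A α,
    Finset.mul_sum]
  refine Finset.dvd_sum fun ω _ => ?_
  obtain ⟨e, he⟩ := h ω.out
  obtain ⟨f, hf⟩ := Subgroup.card_subgroup_dvd_card (MulAction.stabilizer A ω.out)
  rw [← Nat.card_eq_fintype_card, ← Nat.card_eq_fintype_card, he, hf,
    Nat.mul_div_cancel_left _ Nat.card_pos]
  exact ⟨e, by ring⟩

end Action

/-! ### Blocks coming from a maximal subgroup -/

section Method2

open scoped Pointwise

variable {G : Type*} [Group G] (M : Subgroup G) (g : G)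

theorem conjSet_eq_smul (B : Set G) (y : G) :
    conjSet B y = ConjAct.toConjAct y⁻¹ • B := by
  ext z
  simp [conjSet, Set.mem_smul_set, ConjAct.smul_def]

theorem method2Points_eq_orbit : method2Points g = MulAction.orbit (ConjAct G) g := by
  ext z
  rw [ConjAct.mem_orbit_conjAct, isConj_comm]
  rfl

theorem method2Blocks_eq_orbit : method2Blocks M g =
    MulAction.orbit (ConjAct G) ((M : Set G) ∩ conjugatesOf g) := by
  ext B
  constructor
  · rintro ⟨y, rfl⟩
    rw [conjSet_eq_smul]
    exact MulAction.mem_orbit _ _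
  · rintro ⟨a, rfl⟩
    refine ⟨(ConjAct.ofConjAct a)⁻¹, ?_⟩
    rw [conjSet_eq_smul, inv_inv, ConjAct.toConjAct_ofConjAct]

variable {M g}

theorem smul_mem_method2Blocks (a : ConjAct G) (B : Set G) (hB : B ∈ method2Blocks M g) :
    a • B ∈ method2Blocks M g := by
  rw [method2Blocks_eq_orbit] at hB ⊢
  exact MulAction.mem_orbit_of_mem_orbit a hB

theorem block_subset_points {B : Set G} (hB : B ∈ method2Blocks M g) : B ⊆ method2Points g := by
  rw [method2Blocks_eq_orbit] at hB
  obtain ⟨a, rfl⟩ := hB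
  rw [method2Points_eq_orbit]
  rintro _ ⟨z, hz, rfl⟩
  refine MulAction.mem_orbit_of_mem_orbit a ?_
  rw [← method2Points_eq_orbit]
  exact hz.2

theorem ncard_block {B : Set G} (hB : B ∈ method2Blocks M g) :
    B.ncard = ((M : Set G) ∩ conjugatesOf g).ncard := by
  rw [method2Blocks_eq_orbit] at hB
  obtain ⟨a, rfl⟩ := hB
  exact Set.ncard_smul_set a _

/-- A maximal subgroup is the stabilizer of its block: otherwise the block would be invariant under
the whole group and contain the whole conjugacy class. -/
theorem stabilizer_block_eq [Finite G] (hmax : IsCoatom M) (hg : g ∈ M)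
    (hlt : ((M : Set G) ∩ conjugatesOf g).ncard < (method2Points g).ncard) :
    MulAction.stabilizer (ConjAct G) ((M : Set G) ∩ conjugatesOf g) =
      M.map ConjAct.toConjAct.toMonoidHom := by
  set B := (M : Set G) ∩ conjugatesOf g with hB
  let S : Subgroup G := Subgroup.comap (ConjAct.toConjAct : G ≃* ConjAct G).toMonoidHom
    (MulAction.stabilizer (ConjAct G) B)
  have hle : M ≤ S := by
    intro y hy
    change ConjAct.toConjAct y • B = B
    apply Set.eq_of_subset_of_ncard_le
    · rintro _ ⟨z, hz, rfl⟩
      refine ⟨?_, ?_⟩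
      · exact M.mul_mem (M.mul_mem hy hz.1) (M.inv_mem hy)
      · exact IsConj.trans hz.2 (isConj_iff.mpr ⟨y, rfl⟩)
    · rw [Set.ncard_smul_set]
    · exact Set.toFinite _
  have heq : M = S := by
    by_contra hne
    have htop := hmax.2 _ (lt_of_le_of_ne hle hne)
    refine hlt.not_ge (Set.ncard_le_ncard ?_)
    rw [method2Points_eq_orbit]
    rintro _ ⟨a, rfl⟩
    have ha : ConjAct.ofConjAct a ∈ S := by
      rw [htop]
      trivial
    have ha' : a • B = B := ha
    rw [← ha']
    exact Set.smul_mem_smul_set ⟨hg, IsConj.refl g⟩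
  rw [heq]
  exact (Subgroup.map_comap_eq_self_of_surjective ConjAct.toConjAct.surjective _).symm

theorem ncard_method2Blocks [Finite G]
    (hstab : MulAction.stabilizer (ConjAct G) ((M : Set G) ∩ conjugatesOf g) =
      M.map ConjAct.toConjAct.toMonoidHom) : (method2Blocks M g).ncard = M.index := by
  rw [method2Blocks_eq_orbit, ← MulAction.index_stabilizer, hstab]
  exact Subgroup.index_map_equiv M ConjAct.toConjAct

theorem card_stabilizer_of_mem_method2Blocks [Finite G]
    (hstab : MulAction.stabilizer (ConjAct G) ((M : Set G) ∩ conjugatesOf g) =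
      M.map ConjAct.toConjAct.toMonoidHom) {B : Set G} (hB : B ∈ method2Blocks M g) :
    Nat.card (MulAction.stabilizer (ConjAct G) B) = Nat.card M := by
  rw [method2Blocks_eq_orbit] at hB
  have h1 := Subgroup.card_mul_index (MulAction.stabilizer (ConjAct G) B)
  rw [MulAction.index_stabilizer, MulAction.orbit_eq_iff.mpr hB, ← method2Blocks_eq_orbit,
    ncard_method2Blocks hstab] at h1
  have h2 : Nat.card M * M.index = Nat.card (ConjAct G) := Subgroup.card_mul_index M
  exact Nat.eq_of_mul_eq_mul_right (Nat.pos_of_ne_zero M.index_ne_zero_of_finite) (h1.trans h2.symm)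

/-- Points stabilizing a block lie on it. -/
theorem mem_block_of_smul_eq
    (hstab : MulAction.stabilizer (ConjAct G) ((M : Set G) ∩ conjugatesOf g) =
      M.map ConjAct.toConjAct.toMonoidHom) {B : Set G} (hB : B ∈ method2Blocks M g) {h : G}
    (hh : h ∈ method2Points g) (hfix : ConjAct.toConjAct h • B = B) : h ∈ B := by
  rw [method2Blocks_eq_orbit] at hB
  obtain ⟨a, rfl⟩ := hB
  change h ∈ a • ((M : Set G) ∩ conjugatesOf g)
  rw [Set.mem_smul_set_iff_inv_smul_mem]
  have h1 : ConjAct.toConjAct (a⁻¹ • h) ∈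
      MulAction.stabilizer (ConjAct G) ((M : Set G) ∩ conjugatesOf g) := by
    rw [MulAction.mem_stabilizer_iff, show ConjAct.toConjAct (a⁻¹ • h) =
      a⁻¹ * ConjAct.toConjAct h * a from by simp [ConjAct.smul_def], mul_smul, mul_smul]
    change a⁻¹ • ConjAct.toConjAct h • (a • ((M : Set G) ∩ conjugatesOf g)) = _
    rw [hfix]
    exact inv_smul_smul _ _
  rw [hstab] at h1
  obtain ⟨z, hz, hzh⟩ := h1
  have hz' : z = a⁻¹ • h := ConjAct.toConjAct.injective hzh
  refine ⟨hz' ▸ hz, ?_⟩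
  change a⁻¹ • h ∈ method2Points g
  rw [method2Points_eq_orbit] at hh ⊢
  exact MulAction.mem_orbit_of_mem_orbit a⁻¹ hh

/-- The centralizer of `x` acts on `I_x \ {x}` with stabilizers `C(x) ∩ C(y)`. -/
theorem card_stabilizer_dvd_mul_ncard_pointClass_sub_one [Finite G] {d : ℕ} {x : G}
    (hd : ∀ y ∈ pointClass (method2Blocks M g) x, y ≠ x →
      Nat.card (Subgroup.centralizer {x} ⊓ Subgroup.centralizer {y} : Subgroup G) ∣ d) :
    Nat.card (MulAction.stabilizer (ConjAct G) x) ∣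
      d * ((pointClass (method2Blocks M g) x).ncard - 1) := by
  have : Finite (ConjAct G) := ‹Finite G›
  let C := MulAction.stabilizer (ConjAct G) x
  let I : SubMulAction C G :=
    { carrier := pointClass (method2Blocks M g) x \ {x}
      smul_mem' := by
        rintro ⟨c, hc⟩ y ⟨hy, hyx⟩
        have hc' : c • x = x := hc
        change c • y ∈ _
        refine ⟨?_, fun h => hyx ?_⟩
        · rw [← hc', pointClass_smul smul_mem_method2Blocks]
          exact Set.smul_mem_smul_set hy
        · exact MulAction.injective c (Eq.trans h hc'.symm) }
  have hI : Nat.card I = (pointClass (method2Blocks M g) x).ncard - 1 :=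
    Set.ncard_sdiff_singleton_of_mem (mem_pointClass_self _ _)
  rw [← hI]
  refine card_dvd_mul_card_of_card_stabilizer_dvd fun y => ?_
  refine dvd_trans ?_ (hd y y.2.1 y.2.2)
  have hmem : ∀ c : MulAction.stabilizer C y, ConjAct.ofConjAct c.1.1 ∈
      (Subgroup.centralizer {x} ⊓ Subgroup.centralizer {(y : G)} : Subgroup G) := by
    rintro ⟨⟨c, hc⟩, hcy⟩
    have hc1 : c • x = x := hc
    have hc2 : c • (y : G) = y := congrArg Subtype.val hcy
    rw [ConjAct.smul_def, mul_inv_eq_iff_eq_mul] at hc1 hc2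
    exact ⟨Subgroup.mem_centralizer_singleton_iff.mpr hc1,
      Subgroup.mem_centralizer_singleton_iff.mpr hc2⟩
  let f : MulAction.stabilizer C y →*
      (Subgroup.centralizer {x} ⊓ Subgroup.centralizer {(y : G)} : Subgroup G) :=
    (ConjAct.ofConjAct.toMonoidHom.comp
      (C.subtype.comp (MulAction.stabilizer C y).subtype)).codRestrict _ hmem
  refine Subgroup.card_dvd_of_injective f fun c c' h => ?_
  have h' : (f c : G) = f c' := congrArg Subtype.val h
  exact Subtype.ext (Subtype.ext (ConjAct.ofConjAct.injective h'))

end Method2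

/-! ### A nontrivial class when the centralizer has order eight -/

section OrderEight

open scoped Pointwise

/-- Let `z` have a centralizer of order eight, and let `D` have order divisible by eight and
contain a subgroup `H` of order divisible by four whose only involution is `z`. A subgroup of order
four of `H` has index two in a subgroup `S` of order eight of `D`; conjugation by `S` then fixes
its only involution, so `S` is the centralizer of `z`. -/
theorem centralizer_le_of_unique_involution {A : Type*} [Group A] [Finite A] {z : A}
    (hz : Nat.card (Subgroup.centralizer {z}) = 8) {D H : Subgroup A} (hD : 8 ∣ Nat.card D)
    (hH : 4 ∣ Nat.card H) (hHD : H ≤ D) (huniq : ∀ h ∈ H, orderOf h = 2 → h = z) :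
    Subgroup.centralizer {z} ≤ D := by
  obtain ⟨K, hK⟩ := Sylow.exists_subgroup_card_pow_prime (G := H) 2 (n := 2) hH
  have hKH : K.map H.subtype ≤ H := Subgroup.map_subtype_le K
  have hK' : Nat.card (K.map H.subtype) = 2 ^ 2 := by
    rw [Subgroup.card_map_of_injective H.subtype_injective, hK]
  let L : Subgroup D := (K.map H.subtype).subgroupOf D
  have hL : Nat.card L = 2 ^ 2 := by
    rw [← hK']
    exact Nat.card_congr (Subgroup.subgroupOfEquivOfLe (hKH.trans hHD)).toEquiv
  obtain ⟨S, hS, hLS⟩ := Sylow.exists_subgroup_card_pow_succ (G := D) (p := 2) (n := 2) hD hL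
  have hN : (L.subgroupOf S).Normal := by
    apply Subgroup.normal_of_index_eq_two
    have h1 := Subgroup.card_mul_index (L.subgroupOf S)
    rw [Nat.card_congr (Subgroup.subgroupOfEquivOfLe hLS).toEquiv, hL, hS] at h1
    omega
  obtain ⟨t, ht⟩ := exists_prime_orderOf_dvd_card' (G := L) 2 (hL ▸ dvd_pow_self 2 two_ne_zero)
  have inv : ∀ u : D, u ∈ L → orderOf u = 2 → (u : A) = z := by
    intro u hu h
    refine huniq _ (hKH hu) ?_
    rw [← h]
    exact Subgroup.orderOf_coe u
  have ht' : orderOf (t : D) = 2 := by rw [Subgroup.orderOf_coe, ht]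
  have htz := inv t t.2 ht'
  have hSC : S.map D.subtype ≤ Subgroup.centralizer {z} := by
    rintro _ ⟨s, hs, rfl⟩
    have h1 : s * t * s⁻¹ ∈ L := hN.conj_mem ⟨t, hLS t.2⟩ t.2 ⟨s, hs⟩
    have h2 : orderOf (s * t * s⁻¹) = 2 := by
      rw [← ht', ← MulAut.conj_apply]
      exact MulEquiv.orderOf_eq (MulAut.conj s) _
    have h3 := inv _ h1 h2
    rw [Subgroup.mem_centralizer_singleton_iff]
    rw [Subgroup.coe_mul, Subgroup.coe_mul, Subgroup.coe_inv, htz, mul_inv_eq_iff_eq_mul] at h3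
    exact h3
  have heq : S.map D.subtype = Subgroup.centralizer {z} := by
    apply Subgroup.eq_of_le_of_card_ge hSC
    rw [Subgroup.card_map_of_injective D.subtype_injective, hS, hz]
    norm_num
  rw [← heq]
  exact Subgroup.map_subtype_le S

/-- A point `x` on three blocks, with a centralizer `C` of order eight, shares all its blocks with
another point. As `C` permutes the three blocks, the subgroup `H` of `C` fixing all of them has
order divisible by four. Any involution of `H` lies on the three blocks; if `x` is the only one,
then `C` itself fixes the three blocks. -/
theorem exists_ne_mem_pointClass {G : Type*} [Group G] [Finite G] {M : Subgroup G} {g : G}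
    (hstab : MulAction.stabilizer (ConjAct G) ((M : Set G) ∩ conjugatesOf g) =
      M.map ConjAct.toConjAct.toMonoidHom)
    (hM : 8 ∣ Nat.card M) {x : G} (hC : Nat.card (MulAction.stabilizer (ConjAct G) x) = 8)
    (h3 : {B ∈ method2Blocks M g | x ∈ B}.ncard = 3)
    (hinv : ∀ y : G, orderOf y = 2 → y ∈ method2Points g)
    (hcomm : ∃ y : G, orderOf y = 2 ∧ y ≠ x ∧ y * x = x * y) :
    ∃ y ∈ pointClass (method2Blocks M g) x, y ≠ x := by
  classical
  have : Finite (ConjAct G) := ‹Finite G›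
  let C := MulAction.stabilizer (ConjAct G) x
  let T : SubMulAction C (Set G) :=
    { carrier := {B ∈ method2Blocks M g | x ∈ B}
      smul_mem' := by
        rintro ⟨c, hc⟩ B ⟨hB, hx⟩
        have hc' : c • x = x := hc
        change c • B ∈ _
        refine ⟨smul_mem_method2Blocks c B hB, ?_⟩
        rw [← hc']
        exact Set.smul_mem_smul_set hx }
  have hT : Nat.card T = 3 := h3
  let φ := MulAction.toPermHom C T
  let H : Subgroup (ConjAct G) := φ.ker.map C.subtype
  have hH : 4 ∣ Nat.card H := by
    rw [Subgroup.card_map_of_injective C.subtype_injective]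
    have h1 := Subgroup.card_mul_index φ.ker
    rw [Subgroup.index_ker] at h1
    have h2 : Nat.card φ.range ∣ 6 := by
      have := Subgroup.card_subgroup_dvd_card φ.range
      rwa [Nat.card_perm, hT] at this
    have h4 : Nat.card φ.range ∣ 2 := by
      have h8 : Nat.card φ.range ∣ 8 := ⟨_, by rw [← hC, mul_comm]; exact h1.symm⟩
      exact Nat.dvd_gcd h8 h2
    obtain ⟨e, he⟩ := h4
    refine ⟨e, Nat.eq_of_mul_eq_mul_right (Nat.card_pos (α := φ.range)) ?_⟩
    rw [h1]
    change Nat.card (MulAction.stabilizer (ConjAct G) x) = _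
    rw [hC, mul_assoc, mul_comm e, ← he]
    norm_num
  have hHfix : ∀ h ∈ H, ∀ B ∈ method2Blocks M g, x ∈ B → h • B = B := by
    rintro _ ⟨c, hc, rfl⟩ B hB hx
    have h1 : φ c ⟨B, hB, hx⟩ = ⟨B, hB, hx⟩ := by
      rw [MonoidHom.mem_ker.mp hc]
      rfl
    exact congrArg Subtype.val h1
  have key : ∀ y : G, orderOf y = 2 →
      (∀ B ∈ method2Blocks M g, x ∈ B → ConjAct.toConjAct y • B = B) →
      y ∈ pointClass (method2Blocks M g) x := fun y hy hfix => mem_pointClass.mpr fun B hB hx =>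
    mem_block_of_smul_eq hstab hB (hinv y hy) (hfix B hB hx)
  by_cases huniq : ∀ h ∈ H, orderOf h = 2 → h = ConjAct.toConjAct x
  · obtain ⟨y, hy, hne, hyx⟩ := hcomm
    refine ⟨y, key y hy fun B hB hx => ?_, hne⟩
    have hle := centralizer_le_of_unique_involution (D := MulAction.stabilizer (ConjAct G) B)
      (by rw [← ConjAct.stabilizer_eq_centralizer, hC])
      (by rwa [card_stabilizer_of_mem_method2Blocks hstab hB]) hH
      (fun h hh => hHfix h hh B hB hx) huniq
    exact hle (Subgroup.mem_centralizer_singleton_iff.mpr hyx)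
  · push Not at huniq
    obtain ⟨h, hh, ho, hne⟩ := huniq
    refine ⟨ConjAct.ofConjAct h, key _ ?_ fun B hB hx => hHfix h hh B hB hx, hne⟩
    rw [← ho]
    exact MulEquiv.orderOf_eq ConjAct.ofConjAct h

end OrderEight

/-! ### Parameters of the design -/

theorem eq_one_or_eq_three_of_dvd {q m : ℕ} (hq : 3 ≤ q) (hm : 0 < m) (h1 : m ∣ q ^ 2)
    (h2 : q ^ 2 - 1 ∣ 4 * (m - 1)) (hne : m ≠ q ^ 2) : m = 1 ∨ q = 3 ∧ m = 3 := by
  -- Writing `q ^ 2 = Q + 1` removes truncated subtraction.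
  obtain ⟨Q, hQ⟩ : ∃ Q, q ^ 2 = Q + 1 :=
    Nat.exists_eq_succ_of_ne_zero (pow_ne_zero 2 (by omega))
  have hQ8 : 8 ≤ Q := by nlinarith
  rw [hQ] at h1 h2 hne
  have hle := Nat.le_of_dvd (by omega) h1
  obtain ⟨n, rfl⟩ : ∃ n, m = n + 1 := ⟨m - 1, by omega⟩
  rw [Nat.add_sub_cancel, Nat.add_sub_cancel] at h2
  obtain ⟨j, hj⟩ := h2
  have hj4 : j < 4 := by
    by_contra! h
    have := Nat.mul_le_mul_left Q h
    omega
  interval_cases j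
  · left
    omega
  -- Here `4 m = q ^ 2 + 3`, so `m` divides `3`.
  · have h3 : n + 1 ∣ 3 := by
      rw [← Nat.dvd_add_right h1]
      exact ⟨4, by omega⟩
    have := (Nat.dvd_prime Nat.prime_three).mp h3
    right
    have hq9 : q ^ 2 = 3 ^ 2 := by omega
    exact ⟨Nat.pow_left_injective two_ne_zero hq9, by omega⟩
  -- Here `2 m = q ^ 2 + 1`, so `m` divides `1`.
  · have h3 : n + 1 ∣ 1 := by
      rw [← Nat.dvd_add_right h1]
      exact ⟨2, by omega⟩
    have := Nat.dvd_one.mp h3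
    omega
  -- Here `4 m = 3 q ^ 2 + 1`, so `m` divides `1`.
  · have h3 : n + 1 ∣ 1 := by
      rw [← Nat.dvd_add_right (h1.mul_left 3)]
      exact ⟨4, by omega⟩
    have := Nat.dvd_one.mp h3
    omega

theorem two_ne_zero_of_odd_card {F : Type*} [Field F] [Finite F] (h : Odd (Nat.card F)) :
    (2 : F) ≠ 0 := by
  intro h2
  have := Fintype.ofFinite F
  have : CharP F 2 := CharTwo.of_one_ne_zero_of_two_eq_zero one_ne_zero h2
  have h3 := FiniteField.even_card_of_char_two (F := F) ((CharP.ringChar_of_prime_eq_zero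
    Nat.prime_two (by exact_mod_cast h2)))
  rw [← Nat.card_eq_fintype_card] at h3
  rw [Nat.odd_iff] at h
  omega

/-- The numerical part of the argument: the parameters of the design and the sizes of the classes
`I_x` follow from the orders of `G` and `M`, their numbers of involutions, and the orders of
centralizers of pairs of involutions. -/
theorem isDesign_and_ncard_pointClass {G : Type*} [Group G] [Finite G] {M : Subgroup G} {g : G}
    {q : ℕ} (hq3 : 3 ≤ q) (hmax : IsCoatom M) (hgM : g ∈ M)
    (hP : method2Points g = {x | orderOf x = 2})
    (hv : 2 * (method2Points g).ncard = q ^ 2 * (q ^ 2 + 1))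
    (hk : ((M : Set G) ∩ conjugatesOf g).ncard = q ^ 2)
    (hMcard : Nat.card M = q * (q ^ 2 - 1))
    (hGcard : 2 * Nat.card G = q ^ 2 * ((q ^ 2) ^ 2 - 1))
    (hcent : ∀ {x y : G}, orderOf x = 2 → orderOf y = 2 → x ≠ y →
      Nat.card (Subgroup.centralizer {x} ⊓ Subgroup.centralizer {y} : Subgroup G) ∣ 4)
    (hcomm : ∀ {x : G}, orderOf x = 2 → ∃ y : G, orderOf y = 2 ∧ y ≠ x ∧ y * x = x * y) :
    IsDesign (method2Points g) (method2Blocks M g) 1 (q ^ 2 * (q ^ 2 + 1) / 2) (q ^ 2) q ∧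
      ∀ x ∈ method2Points g,
        (3 < q → (pointClass (method2Blocks M g) x).ncard = 1) ∧
        (q = 3 → (pointClass (method2Blocks M g) x).ncard = 3) := by
  -- Writing `q ^ 2 = Q + 1` removes truncated subtraction.
  obtain ⟨Q, hQ⟩ : ∃ Q, q ^ 2 = Q + 1 :=
    Nat.exists_eq_succ_of_ne_zero (pow_ne_zero 2 (by omega))
  have hQ8 : 8 ≤ Q := by nlinarith
  rw [hQ, show (Q + 1) ^ 2 - 1 = Q * (Q + 2) by
    rw [show (Q + 1) ^ 2 = Q * (Q + 2) + 1 by ring, Nat.add_sub_cancel]] at hGcard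
  rw [hQ, Nat.add_sub_cancel] at hMcard
  rw [hQ] at hv
  have hstab := stabilizer_block_eq hmax hgM (by
    rw [hk, hQ]
    nlinarith)
  have hindex : 2 * (method2Blocks M g).ncard = q * (Q + 2) := by
    rw [ncard_method2Blocks hstab]
    have h1 := Subgroup.card_mul_index M
    rw [hMcard] at h1
    apply Nat.eq_of_mul_eq_mul_left (by positivity : 0 < q * Q)
    calc q * Q * (2 * M.index) = 2 * (q * Q * M.index) := by ring
      _ = q ^ 2 * (Q * (Q + 2)) := by rw [h1, hGcard, hQ]
      _ = q * Q * (q * (Q + 2)) := by ring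
  have htrans : ∀ x ∈ method2Points g,
      {B ∈ method2Blocks M g | x ∈ B}.ncard = {B ∈ method2Blocks M g | g ∈ B}.ncard := by
    intro x hx
    rw [method2Points_eq_orbit] at hx
    obtain ⟨a, rfl⟩ := hx
    exact ncard_blocks_through_smul smul_mem_method2Blocks a g
  have hr : ∀ x ∈ method2Points g, {B ∈ method2Blocks M g | x ∈ B}.ncard = q := by
    have h1 := ncard_mul_eq_ncard_mul (P := method2Points g) (𝓑 := method2Blocks M g)
      (fun B hB => block_subset_points hB) (fun B hB => (ncard_block hB).trans hk) htrans
    have h2 : {B ∈ method2Blocks M g | g ∈ B}.ncard = q := by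
      apply Nat.eq_of_mul_eq_mul_left (by positivity : 0 < (Q + 1) * (Q + 1 + 1))
      rw [← hv, mul_assoc, h1, ← mul_assoc, hindex, hv, hQ]
      ring
    exact fun x hx => (htrans x hx).trans h2
  have hC : ∀ x ∈ method2Points g, Nat.card (MulAction.stabilizer (ConjAct G) x) = Q := by
    intro x hx
    rw [method2Points_eq_orbit] at hx
    have h1 := Subgroup.card_mul_index (MulAction.stabilizer (ConjAct G) x)
    rw [MulAction.index_stabilizer, MulAction.orbit_eq_iff.mpr hx, ← method2Points_eq_orbit] at h1
    change _ = Nat.card G at h1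
    apply Nat.eq_of_mul_eq_mul_right (by positivity : 0 < (Q + 1) * (Q + 1 + 1))
    rw [← hv, mul_left_comm, h1, hGcard, hv]
    ring
  refine ⟨⟨Set.toFinite _, ?_, fun B hB => block_subset_points hB,
    fun B hB => (ncard_block hB).trans hk, ?_⟩, ?_⟩
  · rw [hQ, ← hv, Nat.mul_div_cancel_left _ two_pos]
  · intro T hT hT1
    obtain ⟨x, rfl⟩ := Set.ncard_eq_one.mp hT1
    simp only [Set.singleton_subset_iff] at hT ⊢
    exact hr x hT
  intro x hx
  have hx2 : orderOf x = 2 := by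
    rw [hP] at hx
    exact hx
  obtain ⟨B, hB, hxB⟩ : {B ∈ method2Blocks M g | x ∈ B}.Nonempty := by
    rw [← Set.ncard_pos, hr x hx]
    omega
  have hsub : ∀ B ∈ method2Blocks M g, B ⊆ MulAction.orbit (ConjAct G) x := by
    intro B hB
    rw [method2Points_eq_orbit] at hx
    rw [MulAction.orbit_eq_iff.mpr hx, ← method2Points_eq_orbit]
    exact block_subset_points hB
  have hm := eq_one_or_eq_three_of_dvd hq3
    ((Set.ncard_pos).mpr ⟨x, mem_pointClass_self (method2Blocks M g) x⟩)
    (by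
      rw [← hk, ← ncard_block hB]
      exact ncard_pointClass_dvd_ncard_block smul_mem_method2Blocks hB (hsub B hB))
    (by
      rw [hQ, Nat.add_sub_cancel, ← hC x hx]
      refine card_stabilizer_dvd_mul_ncard_pointClass_sub_one fun y hy hyx => ?_
      have hy2 := block_subset_points hB (pointClass_subset hB hxB hy)
      rw [hP] at hy2
      exact hcent hx2 hy2 hyx.symm)
    (by
      -- A class as large as a block would be the only block through `x`.
      intro h
      have hone : {B ∈ method2Blocks M g | x ∈ B} ⊆ {pointClass (method2Blocks M g) x} := by
        rintro B ⟨hB, hxB⟩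
        refine (Set.eq_of_subset_of_ncard_le (pointClass_subset hB hxB) ?_ (Set.toFinite _)).symm
        rw [ncard_block hB, hk, h]
      have := Set.ncard_le_ncard hone
      rw [hr x hx, Set.ncard_singleton] at this
      omega)
  refine ⟨fun h => ?_, fun h => ?_⟩
  · omega
  · subst h
    obtain rfl : Q = 8 := by omega
    obtain ⟨y, hy, hyx⟩ := exists_ne_mem_pointClass hstab (hMcard ▸ ⟨3, rfl⟩) (hC x hx) (hr x hx)
      (fun y hy => by
        rw [hP]
        exact hy)
      (hcomm hx2)
    rcases hm with hm | hm
    · obtain ⟨z, hz⟩ := Set.ncard_eq_one.mp hm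
      have hx' := mem_pointClass_self (method2Blocks M g) x
      rw [hz] at hy hx'
      exact absurd (hy.trans hx'.symm) hyx
    · exact hm.2

theorem mainTheorem9 (q : ℕ) (hq : Odd q)
    (F : Type*) [Field F] [Finite F] (hF : Nat.card F = q)
    (K : Type*) [Field K] [Finite K] (hK : Nat.card K = q ^ 2)
    (M : Subgroup (Matrix.ProjectiveSpecialLinearGroup (Fin 2) K))
    (hmax : IsCoatom M)
    (hM : Nonempty (M ≃* Matrix.ProjGenLinGroup (Fin 2) F))
    (g : Matrix.ProjectiveSpecialLinearGroup (Fin 2) K)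
    (hgM : g ∈ M) (hg : orderOf g = 2) :
    IsDesign (method2Points g) (method2Blocks M g) 1 (q ^ 2 * (q ^ 2 + 1) / 2) (q ^ 2) q ∧
      ∀ x ∈ method2Points g,
        (3 < q → (pointClass (method2Blocks M g) x).ncard = 1) ∧
        (q = 3 → (pointClass (method2Blocks M g) x).ncard = 3) := by
  have hF2 := two_ne_zero_of_odd_card (hF ▸ hq)
  have hK2 : (2 : K) ≠ 0 := two_ne_zero_of_odd_card (hK ▸ hq.pow)
  obtain ⟨i, hi⟩ : ∃ i : K, i ^ 2 = -1 := by
    have := Fintype.ofFinite K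
    obtain ⟨i, hi⟩ := FiniteField.isSquare_neg_one_iff (F := K) |>.mpr (by
      rw [← Nat.card_eq_fintype_card, hK]
      obtain ⟨k, rfl⟩ := hq
      rw [show (2 * k + 1) ^ 2 = 4 * (k ^ 2 + k) + 1 by ring]
      omega)
    exact ⟨i, by rw [hi, sq]⟩
  have hq3 : 3 ≤ q := by
    have : 1 < Nat.card F := Finite.one_lt_card
    obtain ⟨k, rfl⟩ := hq
    omega
  -- All involutions are conjugate, so the points are the involutions.
  have hP : method2Points g = {x | orderOf x = 2} := by
    ext x
    constructor
    · intro h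
      obtain ⟨c, rfl⟩ := isConj_iff.mp h
      exact (MulEquiv.orderOf_eq (MulAut.conj c) g).trans hg
    · exact fun h => isConj_of_orderOf_eq_two_PSL_two hK2 hi hg h
  have hv : 2 * (method2Points g).ncard = q ^ 2 * (q ^ 2 + 1) := by
    rw [hP, two_mul_ncard_involutions_PSL_two hK2 hi, hK]
  have hk : ((M : Set (Matrix.ProjectiveSpecialLinearGroup (Fin 2) K)) ∩
      conjugatesOf g).ncard = q ^ 2 := by
    obtain ⟨e⟩ := hM
    rw [← hF, ← ncard_involutions_PGL_two hF2, ← Set.ncard_image_of_injective _ e.symm.injective,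
      ← Set.ncard_image_of_injective _ (Subtype.val_injective (p := (· ∈ M)))]
    congr 1
    change (M : Set (Matrix.ProjectiveSpecialLinearGroup (Fin 2) K)) ∩ method2Points g = _
    rw [hP]
    ext x
    constructor
    · rintro ⟨hxM, hx⟩
      refine ⟨⟨x, hxM⟩, ⟨e ⟨x, hxM⟩, ?_, e.symm_apply_apply _⟩, rfl⟩
      change orderOf (e _) = 2
      rw [MulEquiv.orderOf_eq, Subgroup.orderOf_mk]
      exact hx
    · rintro ⟨_, ⟨y, hy, rfl⟩, rfl⟩
      refine ⟨(e.symm y).2, ?_⟩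
      change orderOf (e.symm y).1 = 2
      rw [Subgroup.orderOf_coe, MulEquiv.orderOf_eq]
      exact hy
  have hMcard : Nat.card M = q * (q ^ 2 - 1) := by
    obtain ⟨e⟩ := hM
    rw [Nat.card_congr e.toEquiv, card_PGL_two, hF]
  have hGcard : 2 * Nat.card (Matrix.ProjectiveSpecialLinearGroup (Fin 2) K) =
      q ^ 2 * ((q ^ 2) ^ 2 - 1) := by
    rw [card_PSL_two hK2, hK]
  exact isDesign_and_ncard_pointClass hq3 hmax hgM hP hv hk hMcard hGcard
    (card_centralizer_inf_centralizer_dvd_four hK2) (exists_commuting_involution_PSL_two hK2 hi)
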